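/- Association schemes are symmetric: a scheme on a finite set $X$ is a partition of $X\times X$ into non-empty symmetric relations $R_0,\dots,R_d$, with $R_0$ the diagonal, such that for $(x,y)\in R_h$ the number of $z$ with $(x,z)\in R_i$ and $(z,y)\in R_j$ is a constant $p^h_{ij}$; the valency of $R_i$ is $k_i=p^0_{ii}$. An isomorphism of schemes is a bijection of the point sets that carries the relations of one scheme onto those of the other. The relation-distribution diagram of a scheme with respect to (the scheme graph of) a relation $R_1\neq R_0$ has a bubble containing $k_i$ for each relation $R_i$, with the bubble of $R_0$ as its root, and the numbers $p^i_{1j}$ written on the edge from the bubble of $R_i$ to the bubble of $R_j$ (there is no edge if $p^i_{1j}=0$). Let $\mathcal D$ be the metric association scheme of the dodecahedron graph (its relations are "being at distance $i$", $0\le i\le 5$), and let $BD(\mathcal D)$ be its bipartite double scheme, that is, its direct product with the rank-two scheme on two points: on the set of pairs (vertex, $\pm$), its relations are $(i,0)$: "the vertices are at distance $i$ and the signs are equal", and $(i,1)$: "the vertices are at distance $i$ and the signs are different". **Proposition.** The scheme $BD(\mathcal D)$ has, with respect to the relation $(1,1)$ (whose scheme graph is the bipartite double of the dodecahedron graph),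 the following relation-distribution diagram with $12$ bubbles $0,\dots,11$ and root $0$. The numbers in the bubbles $0,\dots,11$ are $$1,\,3,\,6,\,6,\,6,\,3,\,6,\,3,\,3,\,1,\,1,\,1 ,$$ and, writing $i\colon j^{w},\dots$ when $p^i_{1j}=w>0$, the edges are $$\begin{array}{lll} 0\colon 1^{3}; & 1\colon 0^{1},2^{2}; & 2\colon 1^{1},3^{1},4^{1};\\ 3\colon 2^{1},5^{1},6^{1}; & 4\colon 2^{1},6^{1},7^{1}; & 5\colon 3^{2},9^{1};\\ 6\colon 3^{1},4^{1},8^{1}; & 7\colon 4^{2},10^{1}; & 8\colon 6^{2},11^{1};\\ 9\colon 5^{3}; & 10\colon 7^{3}; & 11\colon 8^{3}. \end{array}$$ Conversely, every association scheme that has this relation-distribution diagram with respect to one of its relations $R$ is isomorphic to $BD(\mathcal D)$, by an isomorphism that carries $R$ to the relation $(1,1)$. -/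

import Mathlib

/-- A symmetric association scheme on the finite set `X`, with relations `R_i` indexed by `i : ι`.
The index of the diagonal relation `R_0` is `diag`, and `p i j h` is the intersection number
`p^h_{ij}`; it is determined by the relations because every `R_h` is non-empty. -/
structure AssociationScheme (X : Type*) (ι : Type*) [Finite X] where
  /-- `rel i x y` means `(x, y) ∈ R_i`. -/
  rel : ι → X → X → Prop
  diag : ι
  p : ι → ι → ι → ℕ
  rel_nonempty : ∀ i, ∃ x y, rel i x y
  rel_partition : ∀ x y, ∃! i, rel i x y
  rel_diag : ∀ x y, rel diag x y ↔ x = y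
  rel_symm : ∀ i x y, rel i x y → rel i y x
  rel_card : ∀ i j h x y, rel h x y → {z | rel i x z ∧ rel j z y}.ncard = p i j h

namespace AssociationScheme

/-- The valency `k_i = p^0_{ii}` of the relation `R_i`. -/
def valency {X ι : Type*} [Finite X] (S : AssociationScheme X ι) (i : ι) : ℕ :=
  S.p i i S.diag

/-- An isomorphism of association schemes: a bijection of the point sets that carries the
relations of the first scheme onto those of the second. -/
structure Iso {X ι Y κ : Type*} [Finite X] [Finite Y]
    (S : AssociationScheme X ι) (T : AssociationScheme Y κ) where
  toEquiv : X ≃ Y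
  indexEquiv : ι ≃ κ
  rel_iff : ∀ i x y, T.rel (indexEquiv i) (toEquiv x) (toEquiv y) ↔ S.rel i x y

/-- The direct product of two association schemes. -/
def directProduct {X ι Y κ : Type*} [Finite X] [Finite Y]
    (S : AssociationScheme X ι) (T : AssociationScheme Y κ) :
    AssociationScheme (X × Y) (ι × κ) where
  rel i x y := S.rel i.1 x.1 y.1 ∧ T.rel i.2 x.2 y.2
  diag := (S.diag, T.diag)
  p i j h := S.p i.1 j.1 h.1 * T.p i.2 j.2 h.2
  rel_nonempty i := by
    obtain ⟨x, y, hxy⟩ := S.rel_nonempty i.1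
    obtain ⟨u, v, huv⟩ := T.rel_nonempty i.2
    exact ⟨(x, u), (y, v), hxy, huv⟩
  rel_partition x y := by
    obtain ⟨i, hi, hi'⟩ := S.rel_partition x.1 y.1
    obtain ⟨j, hj, hj'⟩ := T.rel_partition x.2 y.2
    exact ⟨(i, j), ⟨hi, hj⟩, fun k hk => Prod.ext (hi' _ hk.1) (hj' _ hk.2)⟩
  rel_diag x y := by
    rw [S.rel_diag, T.rel_diag, Prod.ext_iff]
  rel_symm i x y h := ⟨S.rel_symm _ _ _ h.1, T.rel_symm _ _ _ h.2⟩
  rel_card i j h x y hxy := by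
    rw [← S.rel_card i.1 j.1 h.1 x.1 y.1 hxy.1, ← T.rel_card i.2 j.2 h.2 x.2 y.2 hxy.2,
      ← Set.ncard_prod]
    congr 1
    ext z
    simp only [Set.mem_ofPred_eq, Set.mem_prod]
    tauto

/-- The association scheme of rank two on two points: `R_0` is equality, `R_1` is inequality. -/
def twoPoints : AssociationScheme (Fin 2) (Fin 2) where
  rel i x y := if i = 0 then x = y else x ≠ y
  diag := 0
  p i j h := if i + j = h then 1 else 0
  rel_nonempty := by decide
  rel_partition := by unfold ExistsUnique; decide
  rel_diag := by decide
  rel_symm := by decide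
  rel_card := by
    intro i j h x y
    rw [Set.ncard_eq_toFinset_card']
    revert i j h x y
    decide

/-- The bipartite double scheme. If `R_i` is a relation with scheme graph `Γ`, then the relation
with index `(i, 1)` has the bipartite double graph of `Γ` as its scheme graph. -/
def bipartiteDouble {X ι : Type*} [Finite X] (S : AssociationScheme X ι) :
    AssociationScheme (X × Fin 2) (ι × Fin 2) :=
  S.directProduct twoPoints

end AssociationScheme

/-! ### The dodecahedron -/

namespace Dodecahedron

/-- Adjacency in the generalized Petersen graph `GP(10, 2)`: the outer vertices `(0, i)` form a
`10`-cycle, the inner vertices `(1, i)` form two `5`-cycles with steps of length `2`, and each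
`(0, i)` is joined to `(1, i)`. -/
def Adj (x y : Fin 2 × ZMod 10) : Prop :=
  (x.1 = 0 ∧ y.1 = 0 ∧ (y.2 = x.2 + 1 ∨ x.2 = y.2 + 1)) ∨
  (x.1 = 1 ∧ y.1 = 1 ∧ (y.2 = x.2 + 2 ∨ x.2 = y.2 + 2)) ∨
  (x.1 ≠ y.1 ∧ x.2 = y.2)

instance : DecidableRel Adj := fun x y => by unfold Adj; infer_instance

/-- The dodecahedron graph, which is the generalized Petersen graph `GP(10, 2)`. -/
def graph : SimpleGraph (Fin 2 × ZMod 10) where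
  Adj := Adj
  symm := ⟨by decide +kernel⟩
  loopless := ⟨by decide +kernel⟩

/-- A table of the distances in the dodecahedron graph. -/
def tab (x y : Fin 2 × ZMod 10) : Fin 6 :=
  match x.1, y.1 with
  | 0, 0 => (![0, 1, 2, 3, 4, 5, 4, 3, 2, 1] : Fin 10 → Fin 6) (y.2 - x.2)
  | 1, 1 => (![0, 3, 1, 4, 2, 5, 2, 4, 1, 3] : Fin 10 → Fin 6) (y.2 - x.2)
  | _, _ => (![1, 2, 2, 3, 3, 4, 3, 3, 2, 2] : Fin 10 → Fin 6) (y.2 - x.2)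

theorem tab_self : ∀ x, tab x x = 0 := by decide +kernel

theorem tab_eq_zero : ∀ x y, tab x y = 0 → x = y := by decide +kernel

theorem tab_adj : ∀ x y z, Adj y z → (tab x z : ℕ) ≤ tab x y + 1 := by decide +kernel

theorem tab_pred : ∀ x y, x ≠ y → ∃ z, Adj z y ∧ (tab x y : ℕ) = tab x z + 1 := by
  decide +kernel

theorem tab_symm : ∀ x y, tab x y = tab y x := by decide +kernel

theorem tab_add (s : ZMod 10) (x y : Fin 2 × ZMod 10) :
    tab (x.1, x.2 + s) (y.1, y.2 + s) = tab x y := by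
  simp only [tab, add_sub_add_right_eq_sub]

theorem tab_card_zero : ∀ (i j : Fin 6) (a : Fin 2) (y : Fin 2 × ZMod 10),
    (Finset.univ.filter fun z => tab (a, 0) z = i ∧ tab z y = j).card =
      (Finset.univ.filter fun z => tab (0, 0) z = i ∧
        tab z (0, ((tab (a, 0) y : ℕ) : ZMod 10)) = j).card := by
  decide +kernel

theorem tab_card (i j : Fin 6) (x y : Fin 2 × ZMod 10) :
    (Finset.univ.filter fun z => tab x z = i ∧ tab z y = j).card =
      (Finset.univ.filter fun z => tab (0, 0) z = i ∧
        tab z (0, ((tab x y : ℕ) : ZMod 10)) = j).card := by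
  have hx := fun z => tab_add (-x.2) x z
  have hy := fun z => tab_add (-x.2) z y
  rw [add_neg_cancel] at hx
  rw [← hx y, ← tab_card_zero i j x.1 (y.1, y.2 + -x.2)]
  refine Finset.card_equiv ((Equiv.refl (Fin 2)).prodCongr (Equiv.addRight (-x.2))) fun z => ?_
  simp only [Finset.mem_filter, Finset.mem_univ, true_and]
  rw [← hx z, ← hy z]
  rfl

theorem exists_walk (n : ℕ) : ∀ x y, (tab x y : ℕ) = n → ∃ w : graph.Walk x y, w.length = n := by
  induction n with
  | zero =>
    intro x y h
    obtain rfl := tab_eq_zero x y (Fin.ext h)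
    exact ⟨.nil, rfl⟩
  | succ n ih =>
    intro x y h
    have hne : x ≠ y := by
      rintro rfl
      rw [tab_self] at h
      simp at h
    obtain ⟨z, hz, hz'⟩ := tab_pred x y hne
    obtain ⟨w, hw⟩ := ih x z (by omega)
    have hz : graph.Adj z y := hz
    exact ⟨w.concat hz, by rw [SimpleGraph.Walk.length_concat, hw]⟩

theorem tab_le_length (x : Fin 2 × ZMod 10) {y z : Fin 2 × ZMod 10} (w : graph.Walk y z) :
    (tab x z : ℕ) ≤ tab x y + w.length := by
  induction w with
  | nil => simp
  | cons h w ih =>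
    have := tab_adj x _ _ h
    rw [SimpleGraph.Walk.length_cons]
    omega

theorem dist_eq (x y : Fin 2 × ZMod 10) : graph.dist x y = tab x y := by
  obtain ⟨w, hw⟩ := exists_walk _ x y rfl
  refine le_antisymm (hw ▸ SimpleGraph.dist_le w) ?_
  obtain ⟨v, hv⟩ := SimpleGraph.Reachable.exists_walk_length_eq_dist ⟨w⟩
  have := tab_le_length x v
  rw [tab_self] at this
  simpa [hv] using this

theorem dist_eq_iff (i : Fin 6) (x y : Fin 2 × ZMod 10) :
    graph.dist x y = (i : ℕ) ↔ tab x y = i := by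
  rw [dist_eq, Fin.ext_iff]

/-- The metric association scheme of the dodecahedron graph: the relation `R_i` consists of the
pairs of vertices at distance `i`, for `0 ≤ i ≤ 5`. -/
noncomputable def scheme : AssociationScheme (Fin 2 × ZMod 10) (Fin 6) where
  rel i x y := graph.dist x y = (i : ℕ)
  diag := 0
  -- the outer vertices `(0, 0)` and `(0, h)` are at distance `h`
  p i j h := {z | graph.dist (0, 0) z = (i : ℕ) ∧
    graph.dist z (0, ((h : ℕ) : ZMod 10)) = (j : ℕ)}.ncard
  rel_nonempty i := by
    refine ⟨(0, 0), (0, ((i : ℕ) : ZMod 10)), ?_⟩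
    rw [dist_eq_iff]
    revert i
    decide +kernel
  rel_partition x y :=
    ⟨tab x y, dist_eq x y, fun i hi => ((dist_eq_iff i x y).1 hi).symm⟩
  rel_diag x y := by
    rw [dist_eq_iff]
    exact ⟨tab_eq_zero x y, fun h => h ▸ tab_self x⟩
  rel_symm i x y h := by rw [SimpleGraph.dist_comm]; exact h
  rel_card i j h x y hxy := by
    rw [dist_eq_iff] at hxy
    subst hxy
    simp only [dist_eq_iff]
    have := tab_card i j x y
    rw [← Set.ncard_coe_finset, ← Set.ncard_coe_finset] at this
    simpa using this

end Dodecahedron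

/-! ### Relation-distribution diagrams -/

/-- A relation-distribution diagram on a set `B` of bubbles. The number inside the bubble `b` is
`size b`; the number written on the edge from `b` to `c`, at the end of `b`, is `weight b c`
(there is no edge if it is zero). The bubble of the diagonal relation is `root`. -/
structure RelationDistributionDiagram (B : Type*) where
  root : B
  size : B → ℕ
  weight : B → B → ℕ

/-- The scheme `S` has the relation-distribution diagram `D` with respect to the scheme graph of
`R_r`: the bubbles of `D` correspond bijectively to the relations, with `k_i` inside the bubble of
`R_i`, and `p^i_{rj}` on the edge from the bubble of `R_i` to the bubble of `R_j`. -/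
def AssociationScheme.HasDiagram {X ι B : Type*} [Finite X] (S : AssociationScheme X ι) (r : ι)
    (D : RelationDistributionDiagram B) : Prop :=
  r ≠ S.diag ∧ ∃ σ : ι ≃ B, σ S.diag = D.root ∧ (∀ i, S.valency i = D.size (σ i)) ∧
    ∀ i j, S.p r j i = D.weight (σ i) (σ j)

/-- The relation-distribution diagram of the bipartite double of the dodecahedron. The bubbles are
numbered by increasing distance from the root: `0 | 1 | 2 | 3, 4 | 5, 6, 7 | 8, 9, 10 | 11`. -/
def dodecahedronDoubleDiagram : RelationDistributionDiagram (Fin 12) where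
  root := 0
  size := ![1, 3, 6, 6, 6, 3, 6, 3, 3, 1, 1, 1]
  weight :=
    ![![0, 3, 0, 0, 0, 0, 0, 0, 0, 0, 0, 0],
      ![1, 0, 2, 0, 0, 0, 0, 0, 0, 0, 0, 0],
      ![0, 1, 0, 1, 1, 0, 0, 0, 0, 0, 0, 0],
      ![0, 0, 1, 0, 0, 1, 1, 0, 0, 0, 0, 0],
      ![0, 0, 1, 0, 0, 0, 1, 1, 0, 0, 0, 0],
      ![0, 0, 0, 2, 0, 0, 0, 0, 0, 1, 0, 0],
      ![0, 0, 0, 1, 1, 0, 0, 0, 1, 0, 0, 0],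
      ![0, 0, 0, 0, 2, 0, 0, 0, 0, 0, 1, 0],
      ![0, 0, 0, 0, 0, 0, 2, 0, 0, 0, 0, 1],
      ![0, 0, 0, 0, 0, 3, 0, 0, 0, 0, 0, 0],
      ![0, 0, 0, 0, 0, 0, 0, 3, 0, 0, 0, 0],
      ![0, 0, 0, 0, 0, 0, 0, 0, 3, 0, 0, 0]]

/-! ### Cubic graphs in which every path of length two lies in a unique pentagon -/

namespace SimpleGraph

/-! The diagram of the bipartite double is a finite computation from the distance table. For the
converse, relation `9` has valency one, so it is a fixed-point-free involution on the points. The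
diagram alone forces composition with it to permute the bubbles by `twist` (`twistsAt`), so relation
`1` composed with it is relation `5`, whose intersection numbers are then known. They make the graph
of relation `5` triangle-free and cubic, with a unique pentagon on every 2-path
(`graph_isPentagonal`). Completing pentagons around one pentagon maps the dodecahedron into it
(`exists_hom`), and the intersection numbers fix the bubble of every pair of images
(`eq_evenBubble_of_hom`). This image and its translate under the involution account for all 40
points (`exists_equiv`). -/

/-- A triangle-free cubic graph in which every path of length two lies in a unique pentagon. -/
structure IsPentagonal {X : Type*} (G : SimpleGraph X) : Prop where
  third : ∀ a b c, G.Adj b a → G.Adj b c → a ≠ c →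
    ∃ o, G.Adj b o ∧ o ≠ a ∧ o ≠ c ∧ ∀ w, G.Adj b w → w = a ∨ w = c ∨ w = o
  two_le : ∀ b, ∃ a c, G.Adj b a ∧ G.Adj b c ∧ a ≠ c
  no_triangle : ∀ a b c, G.Adj a b → G.Adj b c → ¬ G.Adj c a
  exists_pentagon : ∀ a b c, G.Adj a b → G.Adj b c → a ≠ c →
    ∃ d e, G.Adj c d ∧ G.Adj d e ∧ G.Adj e a
  pentagon_unique : ∀ a b c d e d' e', G.Adj a b → G.Adj b c → a ≠ c →
    G.Adj c d → G.Adj d e → G.Adj e a → G.Adj c d' → G.Adj d' e' → G.Adj e' a → d = d' ∧ e = e'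

/-- Four rings of five vertices each: the inner pentagon `0`, its neighbours `1`, the common
neighbours `2` of consecutive vertices of ring `1`, and the outer pentagon `3`. -/
def ringStep (a b : Fin 4 × Fin 5) : Prop :=
  (a.1 = 0 ∧ b = (0, a.2 + 1)) ∨ (a.1 = 0 ∧ b = (1, a.2)) ∨ (a.1 = 1 ∧ b = (2, a.2)) ∨
  (a.1 = 2 ∧ b = (1, a.2 + 1)) ∨ (a.1 = 2 ∧ b = (3, a.2)) ∨ (a.1 = 3 ∧ b = (3, a.2 + 1))

instance : DecidableRel ringStep := fun a b => by unfold ringStep; infer_instance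

variable {X : Type*} {G : SimpleGraph X}

/-- Each ring comes from the previous ones by completing pentagons; the wrong completions violate
triangle-freeness or uniqueness of pentagons. Distinctness of the 20 vertices is not needed here. -/
theorem IsPentagonal.exists_rings (hG : G.IsPentagonal) (x : X) :
    ∃ P Q R S : Fin 5 → X, ∀ k, G.Adj (P k) (P (k + 1)) ∧ G.Adj (P k) (Q k) ∧ G.Adj (Q k) (R k) ∧
      G.Adj (R k) (Q (k + 1)) ∧ G.Adj (R k) (S k) ∧ G.Adj (S k) (S (k + 1)) := by
  have e5 : ∀ k : Fin 5, k + 1 + 1 + 1 + 1 + 1 = k := by decide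
  obtain ⟨p, q, hp, hq, hpq⟩ := hG.two_le x
  obtain ⟨d, e, h1, h2, h3⟩ := hG.exists_pentagon p x q hp.symm hq hpq
  obtain ⟨P, hP⟩ : ∃ P : Fin 5 → X, ∀ k, G.Adj (P k) (P (k + 1)) := by
    refine ⟨![p, x, q, d, e], fun k => ?_⟩
    fin_cases k
    exacts [hp.symm, hq, h1, h2, h3]
  have hP' : ∀ k, G.Adj (P (k + 1 + 1 + 1 + 1)) (P k) := fun k => by
    simpa only [e5] using hP (k + 1 + 1 + 1 + 1)
  have hP2 : ∀ k, P k ≠ P (k + 1 + 1) := fun k h =>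
    hG.no_triangle _ _ _ (hP (k + 1 + 1)) (hP (k + 1 + 1 + 1)) (h ▸ hP' k)
  have hP4 : ∀ k, P (k + 1) ≠ P (k + 1 + 1 + 1 + 1) := fun k h => by
    have := hP2 (k + 1 + 1 + 1 + 1)
    rw [e5] at this
    exact this h.symm
  choose Q hQ hQ1 hQ2 hQ3 using fun k => hG.third _ (P k) _ (hP k) (hP' k).symm (hP4 k)
  have hR : ∀ k, ∃ r, G.Adj (Q k) r ∧ G.Adj r (Q (k + 1)) := fun k => by
    obtain ⟨d, e, h1, h2, h3⟩ :=
      hG.exists_pentagon (Q k) (P k) (P (k + 1)) (hQ k).symm (hP k) (hQ1 k)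
    rcases hQ3 (k + 1) d h1 with rfl | rfl | rfl
    -- The path `P (k+2)`, `P (k+1)`, `P k` would lie in this pentagon and in the initial one,
    -- forcing `Q k = P (k+4)`.
    · exact absurd (hG.pentagon_unique _ _ _ _ _ _ _ (hP (k + 1)).symm (hP k).symm (hP2 k).symm
        (hP' k).symm (hP (k + 1 + 1 + 1)).symm (hP (k + 1 + 1)).symm (hQ k) h3.symm h2.symm).1
        (hQ2 k).symm
    · rw [e5] at h2
      exact absurd (hQ k).symm (hG.no_triangle _ _ _ h2 h3)
    · exact ⟨e, h3.symm, h2.symm⟩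
  choose R hR1 hR2 using hR
  have hPR : ∀ k, P k ≠ R k := fun k h =>
    hG.no_triangle _ _ _ (hP k) (hQ (k + 1)) (h ▸ hR2 k).symm
  have hPR' : ∀ k, P (k + 1) ≠ R k := fun k h =>
    hG.no_triangle _ _ _ (hQ k) (h ▸ hR1 k) (hP k).symm
  have hQQ : ∀ k, Q k ≠ Q (k + 1) := fun k h =>
    hG.no_triangle _ _ _ (hP k) (hQ (k + 1)) (h ▸ (hQ k).symm)
  have hRR : ∀ k, R k ≠ R (k + 1) := fun k h =>
    hP2 k (hG.pentagon_unique _ _ _ _ _ _ _ (hQ (k + 1)) (hR2 k).symm (hPR' k)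
      (hR1 k).symm (hQ k).symm (hP k) (h ▸ hR2 (k + 1)) (hQ (k + 1 + 1)).symm
      (hP (k + 1)).symm).2
  choose S hS hS1 hS2 hS3 using fun k => hG.third _ (R k) _ (hR1 k).symm (hR2 k) (hQQ k)
  refine ⟨P, Q, R, S, fun k => ⟨hP k, hQ k, hR1 k, hR2 k, hS k, ?_⟩⟩
  -- The pentagon on `R k`, `Q (k+1)`, `R (k+1)` must close through `S (k+1)` and `S k`.
  obtain ⟨d, e, h1, h2, h3⟩ :=
    hG.exists_pentagon (R k) (Q (k + 1)) (R (k + 1)) (hR2 k) (hR1 (k + 1)) (hRR k)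
  rcases hS3 (k + 1) d h1 with rfl | rfl | rfl
  · exact absurd (hR2 k) (hG.no_triangle _ _ _ h2 h3)
  · exact absurd (hG.pentagon_unique _ _ _ _ _ _ _ (hR1 (k + 1)) (hR2 (k + 1)) (hQQ (k + 1))
      (hQ (k + 1 + 1)).symm (hP (k + 1)).symm (hQ (k + 1)) h2 h3 (hR2 k)).2 (hPR' k)
  rcases hS3 k e h3.symm with rfl | rfl | rfl
  · exact absurd (hG.pentagon_unique _ _ _ _ _ _ _ (hR1 k) (hR2 k) (hQQ k)
      (hQ (k + 1)).symm (hP k).symm (hQ k) (hR1 (k + 1)) h1 h2).1 (hPR (k + 1))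
  · exact absurd (hR1 (k + 1)) (hG.no_triangle _ _ _ h1 h2)
  · exact h2.symm

/-- The position of a vertex of the dodecahedron in the four rings. -/
def ringPosition (x : Fin 2 × ZMod 10) : Fin 4 × Fin 5 :=
  match x.1 with
  | 0 => (![(1, 0), (2, 0), (1, 1), (2, 1), (1, 2), (2, 2), (1, 3), (2, 3), (1, 4), (2, 4)] :
      Fin 10 → Fin 4 × Fin 5) x.2
  | 1 => (![(0, 0), (3, 0), (0, 1), (3, 1), (0, 2), (3, 2), (0, 3), (3, 3), (0, 4), (3, 4)] :
      Fin 10 → Fin 4 × Fin 5) x.2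

/-- The outer 10-cycle of GP(10, 2) zigzags between rings `1` and `2`; the inner 5-cycles are rings
`0` and `3`. -/
theorem ringStep_of_adj : ∀ x y, Dodecahedron.Adj x y →
    ringStep (ringPosition x) (ringPosition y) ∨ ringStep (ringPosition y) (ringPosition x) := by
  decide +kernel

theorem IsPentagonal.exists_hom (hG : G.IsPentagonal) (x : X) :
    ∃ f : Fin 2 × ZMod 10 → X, ∀ u v, Dodecahedron.Adj u v → G.Adj (f u) (f v) := by
  obtain ⟨P, Q, R, S, h⟩ := hG.exists_rings x
  have key : ∀ a b, ringStep a b →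
      G.Adj ((![P, Q, R, S] : Fin 4 → Fin 5 → X) a.1 a.2)
        ((![P, Q, R, S] : Fin 4 → Fin 5 → X) b.1 b.2) := by
    rintro ⟨a, k⟩ b (⟨rfl, rfl⟩ | ⟨rfl, rfl⟩ | ⟨rfl, rfl⟩ | ⟨rfl, rfl⟩ | ⟨rfl, rfl⟩ | ⟨rfl, rfl⟩)
    exacts [(h k).1, (h k).2.1, (h k).2.2.1, (h k).2.2.2.1, (h k).2.2.2.2.1, (h k).2.2.2.2.2]
  exact ⟨fun v => (![P, Q, R, S] : Fin 4 → Fin 5 → X) (ringPosition v).1 (ringPosition v).2,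
    fun u v huv => (ringStep_of_adj u v huv).elim (key _ _) fun h' => (key _ _ h').symm⟩

end SimpleGraph

namespace Dodecahedron

theorem exists_pentagon : ∀ v w w', Adj v w → Adj v w' → w ≠ w' →
    ∃ x, Adj w x ∧ ∃ y, Adj x y ∧ Adj y w' := by
  decide +kernel

/-- Two neighbours of a vertex are joined by the other three edges of a pentagon; identifying their
images would make a triangle. -/
theorem hom_locally_injective {X : Type*} {G : SimpleGraph X} (hG : G.IsPentagonal)
    {f : Fin 2 × ZMod 10 → X} (hf : ∀ u v, Adj u v → G.Adj (f u) (f v))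
    {v w w' : Fin 2 × ZMod 10} (hw : Adj v w) (hw' : Adj v w') (hne : w ≠ w') : f w ≠ f w' := by
  intro h
  obtain ⟨x, hx, y, hy, hy'⟩ := exists_pentagon v w w' hw hw' hne
  exact hG.no_triangle _ _ _ (hf _ _ hx) (hf _ _ hy) (h ▸ hf _ _ hy')

end Dodecahedron

/-! ### Relation index functions with the diagram of the bipartite double -/

/-- `t x y` is the bubble of the relation that contains `(x, y)`, for a scheme that has the
relation-distribution diagram of the bipartite double of the dodecahedron. -/
structure DoubleIndex {X : Type*} (t : X → X → Fin 12) : Prop where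
  symm : ∀ x y, t x y = t y x
  eq_zero : ∀ x y, t x y = 0 ↔ x = y
  card_size : ∀ x i, {z | t x z = i}.ncard = dodecahedronDoubleDiagram.size i
  card_weight : ∀ x y j,
    {z | t x z = 1 ∧ t z y = j}.ncard = dodecahedronDoubleDiagram.weight (t x y) j

/-! ### The involution given by relation `9` -/

/-- The effect on bubbles of composing with the relation `9` of valency one. -/
def twist : Fin 12 → Fin 12 := ![9, 5, 3, 2, 6, 1, 4, 8, 7, 0, 11, 10]

theorem twist_twist : ∀ i, twist (twist i) = i := by decide

/-- The bubble of the relation "distance `i` and equal signs". -/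
def evenBubble : Fin 6 → Fin 12 := ![0, 5, 2, 6, 7, 11]

namespace DoubleIndex

variable {X : Type*} {t : X → X → Fin 12}

theorem self (ht : DoubleIndex t) (x : X) : t x x = 0 := (ht.eq_zero x x).2 rfl

/-- The scheme graph of the relation `5`. -/
def graph (ht : DoubleIndex t) : SimpleGraph X where
  Adj x y := t x y = 5
  symm := ⟨fun x y h => ht.symm x y ▸ h⟩
  loopless := ⟨fun x h => absurd ((ht.eq_zero x x).2 rfl) (by rw [h]; decide)⟩

theorem exists_adj (ht : DoubleIndex t) {x y : X} {i : Fin 12} (j : Fin 12) (h : t x y = i)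
    (hij : dodecahedronDoubleDiagram.weight i j ≠ 0) : ∃ z, t z x = 1 ∧ t z y = j := by
  rw [← h, ← ht.card_weight x y] at hij
  obtain ⟨z, hz, hz'⟩ := Set.nonempty_of_ncard_ne_zero hij
  exact ⟨z, ht.symm x z ▸ hz, hz'⟩

theorem exists_nine (ht : DoubleIndex t) (x : X) : ∃ y, t x y = 9 := by
  have : {z | t x z = 9}.ncard ≠ 0 := by
    rw [ht.card_size]; decide
  exact Set.nonempty_of_ncard_ne_zero this

variable [Finite X]

theorem weight_ne_zero (ht : DoubleIndex t) {x z : X} (hz : t x z = 1) (y : X) :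
    dodecahedronDoubleDiagram.weight (t x y) (t z y) ≠ 0 := by
  rw [← ht.card_weight x y]
  exact Set.ncard_ne_zero_of_mem ⟨hz, rfl⟩

theorem nine_unique (ht : DoubleIndex t) {x y z : X} (hy : t x y = 9) (hz : t x z = 9) : y = z := by
  have : {z | t x z = 9}.ncard ≤ 1 := by
    rw [ht.card_size]; decide
  exact (Set.ncard_le_one (Set.toFinite _)).1 this y hy z hz

/-- The bubble `i` is twisted correctly when the second point is moved along relation `9`. -/
def TwistsAt (t : X → X → Fin 12) (i : Fin 12) : Prop :=
  ∀ x y y', t y y' = 9 → t x y = i → t x y' = twist i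

/-- If `j` is a neighbour of `i` that is twisted correctly, and all other neighbours of the bubble
`twist j` but `twist i` are twisted correctly, then so is `i`. -/
theorem twistsAt_of_neighbour (ht : DoubleIndex t) (i j : Fin 12) (hj : TwistsAt t j)
    (hij : dodecahedronDoubleDiagram.weight i j ≠ 0)
    (h : ∀ k, dodecahedronDoubleDiagram.weight (twist j) k ≠ 0 → k = twist i ∨ TwistsAt t k) :
    TwistsAt t i := by
  intro x y y' hy hx
  obtain ⟨z, hz, hz'⟩ := ht.exists_adj j hx hij
  have hw := ht.weight_ne_zero hz y'
  rw [hj z y y' hy hz'] at hw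
  rcases h _ hw with h | h
  · exact h
  -- Relation `9` is symmetric, so moving back from `y'` to `y` also twists.
  · rw [h x y' y (ht.symm y y' ▸ hy) rfl] at hx
    rw [← hx, twist_twist]

/-- Bubbles `0` and `9` are clear since relation `9` is a perfect matching. The others follow in an
order that leaves `twist i` as the only unsettled neighbour of `twist j`. -/
theorem twistsAt (ht : DoubleIndex t) : ∀ i, TwistsAt t i := by
  have h0 : TwistsAt t 0 := fun x y y' hy hx => by
    obtain rfl := (ht.eq_zero x y).1 hx
    exact hy
  have h9 : TwistsAt t 9 := fun x y y' hy hx => by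
    obtain rfl := ht.nine_unique (ht.symm x y ▸ hx) hy
    exact ht.self x
  have step := ht.twistsAt_of_neighbour
  have h1 : TwistsAt t 1 := step 1 0 h0 (by decide) fun k hk => by
    have : k = 5 := by revert hk; revert k; decide
    exact .inl this
  have h5 : TwistsAt t 5 := step 5 9 h9 (by decide) fun k hk => by
    have : k = 1 := by revert hk; revert k; decide
    exact .inl this
  have h2 : TwistsAt t 2 := step 2 1 h1 (by decide) fun k hk => by
    have : k = 3 ∨ k = 9 := by revert hk; revert k; decide
    rcases this with rfl | rfl
    exacts [.inl rfl, .inr h9]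
  have h3 : TwistsAt t 3 := step 3 5 h5 (by decide) fun k hk => by
    have : k = 2 ∨ k = 0 := by revert hk; revert k; decide
    rcases this with rfl | rfl
    exacts [.inl rfl, .inr h0]
  have h4 : TwistsAt t 4 := step 4 2 h2 (by decide) fun k hk => by
    have : k = 6 ∨ k = 2 ∨ k = 5 := by revert hk; revert k; decide
    rcases this with rfl | rfl | rfl
    exacts [.inl rfl, .inr h2, .inr h5]
  have h6 : TwistsAt t 6 := step 6 3 h3 (by decide) fun k hk => by
    have : k = 4 ∨ k = 1 ∨ k = 3 := by revert hk; revert k; decide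
    rcases this with rfl | rfl | rfl
    exacts [.inl rfl, .inr h1, .inr h3]
  have h7 : TwistsAt t 7 := step 7 4 h4 (by decide) fun k hk => by
    have : k = 8 ∨ k = 3 ∨ k = 4 := by revert hk; revert k; decide
    rcases this with rfl | rfl | rfl
    exacts [.inl rfl, .inr h3, .inr h4]
  have h8 : TwistsAt t 8 := step 8 6 h6 (by decide) fun k hk => by
    have : k = 7 ∨ k = 2 ∨ k = 6 := by revert hk; revert k; decide
    rcases this with rfl | rfl | rfl
    exacts [.inl rfl, .inr h2, .inr h6]
  have h10 : TwistsAt t 10 := step 10 7 h7 (by decide) fun k hk => by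
    have : k = 11 ∨ k = 6 := by revert hk; revert k; decide
    rcases this with rfl | rfl
    exacts [.inl rfl, .inr h6]
  have h11 : TwistsAt t 11 := step 11 8 h8 (by decide) fun k hk => by
    have : k = 10 ∨ k = 4 := by revert hk; revert k; decide
    rcases this with rfl | rfl
    exacts [.inl rfl, .inr h4]
  intro i
  fin_cases i
  exacts [h0, h1, h2, h3, h4, h5, h6, h7, h8, h9, h10, h11]

theorem twist_right (ht : DoubleIndex t) {y y' : X} (hy : t y y' = 9) (x : X) : t x y' = twist (t x y) :=
  ht.twistsAt _ x y y' hy rfl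

/-! ### Intersection numbers and pentagons of relation `5` -/

theorem card_weight_five (ht : DoubleIndex t) (x y : X) (j : Fin 12) :
    {z | t x z = 5 ∧ t z y = j}.ncard =
      dodecahedronDoubleDiagram.weight (twist (t x y)) j := by
  obtain ⟨x', hx⟩ := ht.exists_nine x
  rw [ht.symm x y, ← ht.twist_right hx y, ht.symm y x', ← ht.card_weight x' y]
  congr 1
  ext z
  have h5 : ∀ k, k = 5 ↔ twist k = 1 := by decide
  have : t x z = 5 ↔ t x' z = 1 := by
    rw [ht.symm x z, ht.symm x' z, ht.twist_right hx z, h5]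
  simp only [Set.mem_ofPred_eq, this]

theorem weight_five_ne_zero (ht : DoubleIndex t) {x z : X} (hz : t x z = 5) (y : X) :
    dodecahedronDoubleDiagram.weight (twist (t x y)) (t z y) ≠ 0 := by
  rw [← ht.card_weight_five x y]
  exact Set.ncard_ne_zero_of_mem ⟨hz, rfl⟩

theorem exists_five (ht : DoubleIndex t) {x y : X} {i : Fin 12} (j : Fin 12) (h : t x y = i)
    (hij : dodecahedronDoubleDiagram.weight (twist i) j ≠ 0) : ∃ z, t x z = 5 ∧ t z y = j := by
  rw [← h, ← ht.card_weight_five x y] at hij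
  exact Set.nonempty_of_ncard_ne_zero hij

theorem five_unique (ht : DoubleIndex t) {x y z z' : X} {i j : Fin 12} (h : t x y = i)
    (hij : dodecahedronDoubleDiagram.weight (twist i) j ≤ 1) (hz : t x z = 5) (hzj : t z y = j)
    (hz' : t x z' = 5) (hzj' : t z' y = j) : z = z' := by
  rw [← h, ← ht.card_weight_five x y] at hij
  exact (Set.ncard_le_one (Set.toFinite _)).1 hij z ⟨hz, hzj⟩ z' ⟨hz', hzj'⟩

theorem eq_two_of_path (ht : DoubleIndex t) {a b c : X} (hab : t a b = 5) (hbc : t b c = 5) (hne : a ≠ c) :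
    t c a = 2 := by
  have h := ht.weight_five_ne_zero hbc a
  rw [ht.symm b a, hab] at h
  have h02 : ∀ k, dodecahedronDoubleDiagram.weight (twist 5) k ≠ 0 → k = 0 ∨ k = 2 := by decide
  exact (h02 _ h).resolve_left fun h0 => hne ((ht.eq_zero _ _).1 h0).symm

/-- From bubble `2`, relation `5` leads to each of `2`, `5`, `6` in exactly one way. Hence a 2-path
from `a` to `c` closes up uniquely: `d` stays in bubble `2` relative to `a`, then `e` is adjacent to
`a`. -/
theorem graph_isPentagonal (ht : DoubleIndex t) : ht.graph.IsPentagonal where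
  third a b c hba hbc hac := by
    have h3 : {z | t b z = 5}.ncard = 3 := ht.card_size b 5
    obtain ⟨x, y, z, hxy, hxz, hyz, h⟩ := Set.ncard_eq_three.1 h3
    have hmem : ∀ w, t b w = 5 ↔ w = x ∨ w = y ∨ w = z := fun w => by
      simpa using Set.ext_iff.1 h w
    change ∃ o, t b o = 5 ∧ o ≠ a ∧ o ≠ c ∧ ∀ w, t b w = 5 → w = a ∨ w = c ∨ w = o
    have ha := (hmem a).1 hba
    have hc := (hmem c).1 hbc
    simp only [hmem]
    rcases ha with rfl | rfl | rfl <;> rcases hc with rfl | rfl | rfl <;>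
      first
      | exact absurd rfl hac
      | exact ⟨x, by tauto⟩
      | exact ⟨y, by tauto⟩
      | exact ⟨z, by tauto⟩
  two_le b := by
    have h3 : 1 < {z | t b z = 5}.ncard := by
      rw [ht.card_size b 5]; decide
    obtain ⟨x, hx, y, hy, h⟩ := (Set.one_lt_ncard (Set.toFinite _)).1 h3
    exact ⟨x, y, hx, hy, h⟩
  no_triangle a b c hab hbc hca := by
    have h := ht.weight_five_ne_zero hbc a
    rw [ht.symm b a, show t a b = 5 from hab, show t c a = 5 from hca] at h
    exact h (by decide)
  exists_pentagon a b c hab hbc hac := by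
    obtain ⟨d, hcd, hd⟩ := ht.exists_five 2 (ht.eq_two_of_path hab hbc hac) (by decide)
    obtain ⟨e, hde, he⟩ := ht.exists_five 5 hd (by decide)
    exact ⟨d, e, hcd, hde, he⟩
  pentagon_unique a b c d e d' e' hab hbc hac hcd hde hea hcd' hde' hea' := by
    have key : ∀ d e, t c d = 5 → t d e = 5 → t e a = 5 → t d a = 2 := fun d e h1 h2 h3 => by
      refine ht.eq_two_of_path (ht.symm e a ▸ h3) (ht.symm d e ▸ h2) ?_
      rintro rfl
      have h := ht.weight_five_ne_zero hbc a
      rw [ht.symm b a, show t a b = 5 from hab, h1] at h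
      exact h (by decide)
    obtain rfl := ht.five_unique (ht.eq_two_of_path hab hbc hac) (by decide) hcd
      (key d e hcd hde hea) hcd' (key d' e' hcd' hde' hea')
    exact ⟨rfl, ht.five_unique (key d e hcd hde hea) (by decide) hde hea hde' hea'⟩

end DoubleIndex

/-! ### Bubbles along a homomorphism from the dodecahedron -/

namespace Dodecahedron

theorem adj_of_tab_eq_one : ∀ u v, tab u v = 1 → Adj u v := by decide +kernel

theorem exists_of_tab_eq_two : ∀ u v, tab u v = 2 → ∃ w, Adj w v ∧ tab u w = 1 := by
  decide +kernel

theorem exists_of_tab_eq_three : ∀ u v, tab u v = 3 → ∃ w, Adj w v ∧ tab u w = 2 ∧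
    (∃ x, Adj w x ∧ tab u x = 1) ∧ ∃ x, Adj w x ∧ x ≠ v ∧ tab u x = 2 := by
  decide +kernel

theorem exists_of_tab_eq_four : ∀ u v, tab u v = 4 → ∃ w, Adj w v ∧ tab u w = 3 ∧
    (∃ x, Adj w x ∧ tab u x = 2) ∧ ∃ x, Adj w x ∧ x ≠ v ∧ tab u x = 3 := by
  decide +kernel

theorem exists_of_tab_eq_five : ∀ u v, tab u v = 5 → ∃ w, Adj v w ∧ tab u w = 4 ∧
    ∃ w', Adj v w' ∧ w ≠ w' ∧ tab u w' = 4 := by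
  decide +kernel

end Dodecahedron

namespace DoubleIndex

open Dodecahedron

variable {X : Type*} [Finite X] {t : X → X → Fin 12}

/-- By increasing distance. At distances 3 and 4, the bubble of the preceding vertex `w` has three
continuations of weight one; two are taken by the other neighbours of `w`, whose images differ from
that of `v`. -/
theorem eq_evenBubble_of_hom (ht : DoubleIndex t) {f : Fin 2 × ZMod 10 → X}
    (hf : ∀ u v, Adj u v → t (f u) (f v) = 5) (u v : Fin 2 × ZMod 10) :
    t (f u) (f v) = evenBubble (tab u v) := by
  have inj : ∀ {v w w'}, Adj v w → Adj v w' → w ≠ w' → f w ≠ f w' := fun hw hw' hne =>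
    hom_locally_injective ht.graph_isPentagonal hf hw hw' hne
  have symm : ∀ {v w}, Adj v w → Adj w v := fun h => Dodecahedron.graph.adj_symm h
  have D1 : ∀ u v, tab u v = 1 → t (f v) (f u) = 5 := fun u v h =>
    ht.symm (f u) (f v) ▸ hf _ _ (adj_of_tab_eq_one u v h)
  have D2 : ∀ u v, tab u v = 2 → t (f v) (f u) = 2 := fun u v h => by
    obtain ⟨w, hwv, hw⟩ := exists_of_tab_eq_two u v h
    have huw := adj_of_tab_eq_one u w hw
    refine ht.eq_two_of_path (hf _ _ huw) (hf _ _ hwv) (inj (symm huw) hwv ?_)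
    rintro rfl
    rw [tab_self] at h
    exact absurd h (by decide)
  have D3 : ∀ u v, tab u v = 3 → t (f v) (f u) = 6 := fun u v h => by
    obtain ⟨w, hwv, hw, ⟨x, hx, hx1⟩, y, hy, hyv, hy2⟩ := exists_of_tab_eq_three u v h
    have hwu := D2 u w hw
    have hne := ht.weight_five_ne_zero (hf _ _ hwv) (f u)
    rw [hwu] at hne
    have hk : ∀ k, dodecahedronDoubleDiagram.weight (twist 2) k ≠ 0 → k = 5 ∨ k = 2 ∨ k = 6 := by
      decide
    rcases hk _ hne with h' | h' | h'
    · refine absurd (ht.five_unique hwu (by decide) (hf _ _ hwv) h' (hf _ _ hx) (D1 u x hx1))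
        (inj hwv hx ?_)
      rintro rfl
      rw [h] at hx1
      exact absurd hx1 (by decide)
    · exact absurd (ht.five_unique hwu (by decide) (hf _ _ hwv) h' (hf _ _ hy) (D2 u y hy2))
        (inj hwv hy hyv.symm)
    · exact h'
  have D4 : ∀ u v, tab u v = 4 → t (f v) (f u) = 7 := fun u v h => by
    obtain ⟨w, hwv, hw, ⟨x, hx, hx1⟩, y, hy, hyv, hy2⟩ := exists_of_tab_eq_four u v h
    have hwu := D3 u w hw
    have hne := ht.weight_five_ne_zero (hf _ _ hwv) (f u)
    rw [hwu] at hne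
    have hk : ∀ k, dodecahedronDoubleDiagram.weight (twist 6) k ≠ 0 → k = 2 ∨ k = 6 ∨ k = 7 := by
      decide
    rcases hk _ hne with h' | h' | h'
    · refine absurd (ht.five_unique hwu (by decide) (hf _ _ hwv) h' (hf _ _ hx) (D2 u x hx1))
        (inj hwv hx ?_)
      rintro rfl
      rw [h] at hx1
      exact absurd hx1 (by decide)
    · exact absurd (ht.five_unique hwu (by decide) (hf _ _ hwv) h' (hf _ _ hy) (D3 u y hy2))
        (inj hwv hy hyv.symm)
    · exact h'
  have D5 : ∀ u v, tab u v = 5 → t (f v) (f u) = 11 := fun u v h => by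
    obtain ⟨w, hw, hw4, w', hw', hne, hw4'⟩ := exists_of_tab_eq_five u v h
    have hwu := D4 u w hw4
    have hn := ht.weight_five_ne_zero (hf _ _ hw) (f u)
    rw [hwu] at hn
    -- Seen from `v`: bubble `6` has only one step to `7`, but `v` has two neighbours at distance 4
    -- from `u`.
    have hk : ∀ k, dodecahedronDoubleDiagram.weight (twist k) 7 ≠ 0 → k = 6 ∨ k = 11 := by
      decide
    rcases hk _ hn with h' | h'
    · exact absurd (ht.five_unique h' (by decide) (hf _ _ hw) hwu (hf _ _ hw') (D4 u w' hw4'))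
        (inj hw hw' hne)
    · exact h'
  rw [ht.symm]
  generalize hi : tab u v = i
  fin_cases i
  · obtain rfl := tab_eq_zero u v hi
    exact ht.self _
  exacts [D1 u v hi, D2 u v hi, D3 u v hi, D4 u v hi, D5 u v hi]

theorem card_eq (ht : DoubleIndex t) (x : X) : Nat.card X = 40 := by
  have := Fintype.ofFinite X
  classical
  rw [Nat.card_eq_fintype_card, ← Finset.card_univ,
    Finset.card_eq_sum_card_fiberwise (f := t x) (t := Finset.univ) (fun _ _ => Finset.mem_univ _)]
  have h : ∀ i, (Finset.univ.filter fun z => t x z = i).card = dodecahedronDoubleDiagram.size i :=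
    fun i => by
      rw [← ht.card_size x i, ← Set.ncard_coe_finset]
      simp
  simp only [h]
  decide

end DoubleIndex

/-! ### The isomorphism with the bipartite double -/

/-- The bubbles of the diagram as relations of the bipartite double scheme: the distance of the
vertices, and whether the signs differ. -/
def bubbleEquiv : Fin 12 ≃ Fin 6 × Fin 2 where
  toFun := ![(0, 0), (1, 1), (2, 0), (2, 1), (3, 1), (1, 0), (3, 0), (4, 0), (4, 1), (0, 1), (5, 1),
    (5, 0)]
  invFun a := if a.2 = 0 then evenBubble a.1 else twist (evenBubble a.1)
  left_inv := by decide
  right_inv := by decide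

namespace DoubleIndex

open Dodecahedron

variable {X : Type*} [Finite X] {t : X → X → Fin 12}

theorem exists_equiv (ht : DoubleIndex t) (x : X) :
    ∃ φ : (Fin 2 × ZMod 10) × Fin 2 ≃ X, ∀ a b, t (φ a) (φ b) =
      bubbleEquiv.symm (tab a.1 b.1, if a.2 = b.2 then 0 else 1) := by
  obtain ⟨f, hf⟩ := ht.graph_isPentagonal.exists_hom x
  have hf' := ht.eq_evenBubble_of_hom hf
  choose s hs using ht.exists_nine
  have h1 : ∀ x y, t x (s y) = twist (t x y) := fun x y => ht.twist_right (hs y) x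
  have h2 : ∀ x y, t (s x) y = twist (t x y) := fun x y => by
    rw [ht.symm, h1, ht.symm]
  let g : (Fin 2 × ZMod 10) × Fin 2 → X := fun a => if a.2 = 0 then f a.1 else s (f a.1)
  have hg : ∀ a b, t (g a) (g b) =
      bubbleEquiv.symm (tab a.1 b.1, if a.2 = b.2 then 0 else 1) := by
    rintro ⟨a, i⟩ ⟨b, j⟩
    fin_cases i <;> fin_cases j <;> simp [g, bubbleEquiv, h1, h2, hf', twist_twist]
  -- Equal images lie in bubble `0`, which forces distance zero and equal signs.
  have hinj : Function.Injective g := fun a b h => by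
    have h0 := hg a b
    rw [h, ht.self, eq_comm, Equiv.symm_apply_eq, Prod.ext_iff] at h0
    refine Prod.ext (tab_eq_zero _ _ h0.1) ?_
    by_contra hne
    rw [if_neg hne] at h0
    exact absurd h0.2 (by change (1 : Fin 2) ≠ 0; decide)
  have hbij : Function.Bijective g := by
    refine hinj.bijective_of_nat_card_le ?_
    rw [ht.card_eq x, Nat.card_eq_fintype_card]
    decide
  exact ⟨Equiv.ofBijective g hbij, hg⟩

end DoubleIndex

namespace AssociationScheme

variable {X ι : Type*} [Finite X]

theorem doubleIndex_of_hasDiagram (S : AssociationScheme X ι) (r : ι)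
    (h : S.HasDiagram r dodecahedronDoubleDiagram) :
    ∃ (σ : ι ≃ Fin 12) (t : X → X → Fin 12), σ r = 1 ∧ DoubleIndex t ∧
      ∀ i x y, S.rel i x y ↔ t x y = σ i := by
  obtain ⟨hr, σ, hσ, hsize, hweight⟩ := h
  choose u hu hu' using S.rel_partition
  have hrel : ∀ i x y, S.rel i x y ↔ σ (u x y) = σ i := fun i x y =>
    ⟨fun h => by rw [hu' x y i h], fun h => σ.injective h ▸ hu x y⟩
  obtain ⟨x₀, y₀, hxy⟩ := S.rel_nonempty r
  have hσ' : σ S.diag = 0 := hσ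
  have hr1 : σ r = 1 := by
    -- Bubble `1` is the only neighbour of the root.
    have h1 : S.p r r S.diag ≠ 0 := by
      rw [← S.rel_card r r S.diag x₀ x₀ ((S.rel_diag _ _).2 rfl)]
      exact Set.ncard_ne_zero_of_mem ⟨hxy, S.rel_symm _ _ _ hxy⟩
    rw [hweight, hσ'] at h1
    revert h1
    generalize σ r = k
    revert k
    decide
  refine ⟨σ, fun x y => σ (u x y), hr1, ⟨fun x y => ?_, fun x y => ?_, fun x i => ?_,
    fun x y j => ?_⟩, hrel⟩
  · exact congrArg σ (hu' y x _ (S.rel_symm _ _ _ (hu x y)))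
  · rw [← hσ', ← hrel, S.rel_diag]
  · obtain ⟨i, rfl⟩ := σ.surjective i
    rw [← hsize, valency, ← S.rel_card i i S.diag x x ((S.rel_diag _ _).2 rfl)]
    congr 1
    ext z
    exact ⟨fun h => ⟨(hrel _ _ _).2 h, S.rel_symm _ _ _ ((hrel _ _ _).2 h)⟩,
      fun h => (hrel _ _ _).1 h.1⟩
  · obtain ⟨j, rfl⟩ := σ.surjective j
    rw [← hweight, ← S.rel_card r j _ x y (hu x y)]
    congr 1
    ext z
    simp only [Set.mem_ofPred_eq, hrel, hr1]

end AssociationScheme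

/-! ### Computing the diagram of the bipartite double -/

namespace Dodecahedron

theorem scheme_p_eq (i j h : Fin 6) : scheme.p i j h =
    (Finset.univ.filter fun z => tab (0, 0) z = i ∧ tab z (0, ((h : ℕ) : ZMod 10)) = j).card := by
  simp only [scheme, dist_eq_iff]
  rw [← Set.ncard_coe_finset]
  simp

theorem bipartiteDouble_valency : ∀ i : Fin 6 × Fin 2, scheme.bipartiteDouble.valency i =
    dodecahedronDoubleDiagram.size (bubbleEquiv.symm i) := by
  intro i
  change scheme.p i.1 i.1 0 * AssociationScheme.twoPoints.p i.2 i.2 0 = _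
  rw [scheme_p_eq]
  revert i
  decide +kernel

theorem bipartiteDouble_p : ∀ i j : Fin 6 × Fin 2, scheme.bipartiteDouble.p (1, 1) j i =
    dodecahedronDoubleDiagram.weight (bubbleEquiv.symm i) (bubbleEquiv.symm j) := by
  intro i j
  change scheme.p 1 j.1 i.1 * AssociationScheme.twoPoints.p 1 j.2 i.2 = _
  rw [scheme_p_eq]
  revert i j
  decide +kernel

theorem bipartiteDouble_hasDiagram :
    scheme.bipartiteDouble.HasDiagram (1, 1) dodecahedronDoubleDiagram :=
  ⟨fun h => absurd (congrArg Prod.snd h) (by change (1 : Fin 2) ≠ 0; decide), bubbleEquiv.symm, rfl,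
    bipartiteDouble_valency, bipartiteDouble_p⟩

end Dodecahedron

theorem mainTheorem9 :
    Dodecahedron.scheme.bipartiteDouble.HasDiagram (1, 1) dodecahedronDoubleDiagram ∧
    ∀ (X : Type*) (ι : Type*) [Finite X] (S : AssociationScheme X ι) (r : ι),
      S.HasDiagram r dodecahedronDoubleDiagram →
        ∃ φ : S.Iso Dodecahedron.scheme.bipartiteDouble, φ.indexEquiv r = (1, 1) := by
  refine ⟨Dodecahedron.bipartiteDouble_hasDiagram, fun X ι _ S r h => ?_⟩
  obtain ⟨σ, t, hr, ht, hrel⟩ := S.doubleIndex_of_hasDiagram r h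
  obtain ⟨x, -⟩ := S.rel_nonempty r
  obtain ⟨φ, hφ⟩ := ht.exists_equiv x
  refine ⟨⟨φ.symm, σ.trans bubbleEquiv, fun i x y => ?_⟩, ?_⟩
  · obtain ⟨a, rfl⟩ := φ.surjective x
    obtain ⟨b, rfl⟩ := φ.surjective y
    rw [hrel, hφ, Equiv.symm_apply_eq, φ.symm_apply_apply, φ.symm_apply_apply, Equiv.trans_apply]
    generalize bubbleEquiv (σ i) = k
    have h2 : ∀ (k a b : Fin 2), AssociationScheme.twoPoints.rel k a b ↔
        (if a = b then 0 else 1) = k := by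
      change ∀ (k a b : Fin 2), (if k = 0 then a = b else a ≠ b) ↔ _
      decide
    rw [Prod.ext_iff, ← Dodecahedron.dist_eq_iff, ← h2]
    rfl
  · rw [Equiv.trans_apply, hr]
    rfl
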